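/- Let $G=(V,E,w)$ be a finite weighted hypergraph: $V$ is a finite set, $E$ a finite family of non-empty subsets of $V$ (hyperedges), and $w\colon E\to[0,\infty)$. Let $d_G(v)=\sum_{e\in E:\,v\in e}w(e)$, let $D=\mathrm{diag}(d_G(v))_{v\in V}$, and assume $d_G(v)>0$ for every $v\in V$. For $e\in E$ let $B_e=\mathrm{conv}\{\mathbf 1_u-\mathbf 1_v : u,v\in e\}\subseteq\mathbb{R}^V$. The Laplacian is the multivalued operator $$L_G(x)=\Bigl\{\sum_{e\in E}w(e)\,b_eb_e^{\top}x \;:\; b_e\in\operatorname*{argmax}_{b\in B_e}b^{\top}x \text{ for each } e\in E\Bigr\}\subseteq\mathbb{R}^V ,$$ and the normalized Laplacian is $\mathcal{L}_G(x)=L_G(D^{-1}x)$. Equip $\mathbb{R}^V$ with the inner product $\langle x,y\rangle_{D^{-1}}=x^{\top}D^{-1}y$. A multivalued operator $A\colon\mathbb{R}^V\to 2^{\mathbb{R}^V}$ is monotone if $\langle y-y',x-x'\rangle_{D^{-1}}\ge 0$ whenever $y\in A(x)$ and $y'\in A(x')$; a monotone $A$ is maximal if every monotone $B$ with $A(x)\subseteq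 B(x)$ for all $x$ equals $A$. Then $\mathcal{L}_G$ is maximal monotone. Moreover, for every $s\in\mathbb{R}^V$ the heat equation $$\frac{d\rho_t}{dt}\in-\mathcal{L}_G(\rho_t),\qquad \rho_0=s,$$ has exactly one global solution, where a global solution is a map $\rho\colon[0,\infty)\to\mathbb{R}^V$ that is absolutely continuous on every interval $[0,T]$, satisfies $\rho_0=s$, and for almost every $t\ge0$ is differentiable at $t$ with $\frac{d\rho_t}{dt}\in-\mathcal{L}_G(\rho_t)$. -/

import Mathlib

open scoped Matrix

/-- A finite weighted hypergraph with vertex set `V` and hyperedges indexed by `E` (a set of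
hyperedges, or a family with repetitions). Hyperedges are non-empty and may have any size. -/
structure WeightedHypergraph (V E : Type*) where
  verts : E → Finset V
  verts_nonempty : ∀ e, (verts e).Nonempty
  weight : E → ℝ
  weight_nonneg : ∀ e, 0 ≤ weight e

namespace WeightedHypergraph

variable {V E : Type*} [Fintype V] [DecidableEq V] [Fintype E]

/-- The weighted degree `d_G(v) = ∑_{e ∋ v} w(e)`. -/
def degree (G : WeightedHypergraph V E) (v : V) : ℝ :=
  ∑ e with v ∈ G.verts e, G.weight e

/-- The degree matrix `D_G`. -/
def degreeMatrix (G : WeightedHypergraph V E) : Matrix V V ℝ :=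
  Matrix.diagonal G.degree

/-- The polytope `B_e = conv {1_u - 1_v | u, v ∈ e}`. -/
def polytope (G : WeightedHypergraph V E) (e : E) : Set (V → ℝ) :=
  convexHull ℝ {b | ∃ u ∈ G.verts e, ∃ v ∈ G.verts e, b = Pi.single u 1 - Pi.single v 1}

/-- The set `argmax_{b ∈ B_e} bᵀ x`. -/
def argmaxPolytope (G : WeightedHypergraph V E) (e : E) (x : V → ℝ) : Set (V → ℝ) :=
  {b | b ∈ G.polytope e ∧ ∀ c ∈ G.polytope e, c ⬝ᵥ x ≤ b ⬝ᵥ x}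

/-- The multivalued Laplacian
`L_G(x) = {∑_e w(e) b_e b_eᵀ x | b_e ∈ argmax_{b ∈ B_e} bᵀ x}`. -/
def laplacian (G : WeightedHypergraph V E) (x : V → ℝ) : Set (V → ℝ) :=
  {y | ∃ b : E → V → ℝ, (∀ e, b e ∈ G.argmaxPolytope e x) ∧
    y = ∑ e, G.weight e • (Matrix.vecMulVec (b e) (b e) *ᵥ x)}

/-- The normalized Laplacian `x ↦ L_G(D_G⁻¹ x)`. -/
noncomputable def normalizedLaplacian (G : WeightedHypergraph V E) (x : V → ℝ) : Set (V → ℝ) :=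
  G.laplacian (G.degreeMatrix⁻¹ *ᵥ x)

/-- The inner product `⟨x, y⟩_{D⁻¹} = xᵀ D_G⁻¹ y` on `ℝ^V`. -/
noncomputable def innerDInv (G : WeightedHypergraph V E) (x y : V → ℝ) : ℝ :=
  x ⬝ᵥ (G.degreeMatrix⁻¹ *ᵥ y)

/-- `ρ` (only its values at times `t ≥ 0` matter) is a global solution of the heat equation
`dρ/dt ∈ -𝓛_G(ρ)`, `ρ_0 = s`: it is absolutely continuous on every bounded interval `[0, T]`,
starts at `s`, and for almost every `t ≥ 0` it is differentiable at `t` with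
derivative in `-𝓛_G(ρ_t)`. -/
def IsHeatSolution (G : WeightedHypergraph V E) (s : V → ℝ) (ρ : ℝ → V → ℝ) : Prop :=
  (∀ T : ℝ, 0 ≤ T → AbsolutelyContinuousOnInterval ρ 0 T) ∧
  ρ 0 = s ∧
  ∀ᵐ t ∂(MeasureTheory.volume.restrict (Set.Ici (0 : ℝ))),
    ∃ y ∈ G.normalizedLaplacian (ρ t), HasDerivAt ρ (-y) t

end WeightedHypergraph

/-- A multivalued operator `A` is monotone with respect to the inner product `ip`. -/
def IsMonotoneOperator {X : Type*} [AddCommGroup X] (ip : X → X → ℝ) (A : X → Set X) : Prop :=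
  ∀ x x' : X, ∀ y ∈ A x, ∀ y' ∈ A x', 0 ≤ ip (y - y') (x - x')

/-- `A` is monotone, and its graph is not properly contained in that of a monotone operator. -/
def IsMaximalMonotoneOperator {X : Type*} [AddCommGroup X] (ip : X → X → ℝ) (A : X → Set X) :
    Prop :=
  IsMonotoneOperator ip A ∧
    ∀ B : X → Set X, IsMonotoneOperator ip B → (∀ x, A x ⊆ B x) → A = B

/-!
The operator `L_G` is (up to a factor) the subdifferential of the convex function
`x ↦ ∑ e, w e * (max_{b ∈ B_e} bᵀ x) ^ 2`, and the heat equation is a gradient flow for the inner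
product `⟨·, ·⟩_{D⁻¹}`. The proof uses only the following properties of `𝓛_G`: it is monotone, its
values are non-empty and convex, its graph is closed, and it grows at most linearly. Monotonicity is
`(p - q) ^ 2 ≥ 0`, hyperedge by hyperedge, where `p` and `q` are the maxima of `bᵀ x` and `bᵀ x'`
over `B_e` (`laplacian_monotone`).

The analysis takes place in a finite-dimensional normed space `X` with a symmetric positive definite
form `B`; the norm of `X` need not come from `B`, so the sup norm of `V → ℝ` is kept.

* Maximality (`IsMonotoneOperator.isMaximalMonotoneOperator`): a pair monotonically related to the
  graph, but outside it, would be separated from the value of the operator by a hyperplane, and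
  closedness of the graph along the normal direction contradicts this.
* Existence (`IsMaximalMonotoneOperator.exists_solution`): the explicit Euler scheme satisfies a
  discrete energy inequality against every point `(x, y)` of the graph
  (`IsMonotoneOperator.eulerStep_energy_le`). The inequality involves the values of the scheme at two
  times only, so a pointwise limit along an ultrafilter inherits it, and no uniform or weak
  convergence is needed. Differentiating the limit inequality shows that `-ρ'` is monotonically
  related to the graph, and maximality puts it in `A (ρ t)`.
* Uniqueness (`IsMonotoneOperator.eq_of_absolutelyContinuous`): for two solutions `B w w`, with `w`
  their difference, is absolutely continuous with almost everywhere non-positive derivative.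
-/

open scoped Matrix
open Filter Topology MeasureTheory

section Abstract

variable {X : Type*} [NormedAddCommGroup X] [NormedSpace ℝ X]
  {B : X →L[ℝ] X →L[ℝ] ℝ} {A : X → Set X}

/-! ### Maximal monotone operators -/

/-- A maximal monotone operator contains every pair that is monotonically related to its graph. -/
theorem IsMaximalMonotoneOperator.mem_of_forall
    (hA : IsMaximalMonotoneOperator (fun x y => B x y) A) {x₀ y₀ : X}
    (h : ∀ x, ∀ y ∈ A x, 0 ≤ B (y₀ - y) (x₀ - x)) : y₀ ∈ A x₀ := by
  have key := hA.2 (fun x => A x ∪ {y | x = x₀ ∧ y = y₀}) ?_ fun x => Set.subset_union_left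
  · rw [key]
    exact Or.inr ⟨rfl, rfl⟩
  · rintro x x' y (hy | ⟨rfl, rfl⟩) y' (hy' | ⟨rfl, rfl⟩)
    · exact hA.1 x x' y hy y' hy'
    · have := h x y hy
      rw [← neg_sub y, ← neg_sub x, map_neg, map_neg, neg_apply,
        neg_neg] at this
      exact this
    · exact h x' y' hy'
    · simp

/-- Every linear functional is represented by a positive definite form in finite dimension. -/
theorem exists_forall_apply_eq_of_pos_def [FiniteDimensional ℝ X]
    (hpos : ∀ x, x ≠ 0 → 0 < B x x) (f : X →L[ℝ] ℝ) : ∃ v, ∀ y, B y v = f y := by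
  let Φ : X →ₗ[ℝ] Module.Dual ℝ X :=
    { toFun := fun v => (B.flip v).toLinearMap
      map_add' := fun v w => by ext; simp
      map_smul' := fun c v => by ext; simp }
  have hinj : Function.Injective Φ := by
    rw [← LinearMap.ker_eq_bot, LinearMap.ker_eq_bot']
    intro v hv
    by_contra hne
    exact (hpos v hne).ne' (LinearMap.congr_fun hv v)
  obtain ⟨v, hv⟩ := (LinearMap.injective_iff_surjective_of_finrank_eq_finrank
    Subspace.dual_finrank_eq.symm).1 hinj f.toLinearMap
  exact ⟨v, fun y => LinearMap.congr_fun hv y⟩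

/-- A monotone operator with non-empty convex values, closed graph and at most linear growth is
maximal. If `y₀ ∉ A x₀` were monotonically related to the graph, then a functional `B · v` would
separate `y₀` from `A x₀`; a limit of values of `A` at `x₀ - v / (n + 1)` lies in `A x₀`, but on the
wrong side of the separating hyperplane. -/
theorem IsMonotoneOperator.isMaximalMonotoneOperator [FiniteDimensional ℝ X]
    (hpos : ∀ x, x ≠ 0 → 0 < B x x) (hA : IsMonotoneOperator (fun x y => B x y) A)
    (hne : ∀ x, (A x).Nonempty) (hconv : ∀ x, Convex ℝ (A x))
    (hclosed : IsClosed {p : X × X | p.2 ∈ A p.1})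
    {C : ℝ} (hC : 0 ≤ C) (hgrowth : ∀ x, ∀ y ∈ A x, ‖y‖ ≤ C * ‖x‖) :
    IsMaximalMonotoneOperator (fun x y => B x y) A := by
  have : ProperSpace X := FiniteDimensional.proper_real X
  refine ⟨hA, fun A' hA' hsub => funext fun x₀ => (hsub x₀).antisymm fun y₀ hy₀ => ?_⟩
  by_contra hnot
  have hval : IsClosed (A x₀) :=
    hclosed.preimage (f := fun y => (x₀, y)) (by fun_prop)
  obtain ⟨f, u, hfu, huf⟩ := geometric_hahn_banach_point_closed (hconv x₀) hval hnot
  obtain ⟨v, hv⟩ := exists_forall_apply_eq_of_pos_def hpos f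
  choose a ha using hne
  let r : ℕ → ℝ := fun n => 1 / ((n : ℝ) + 1)
  have hr : ∀ n, 0 < r n := fun n => by positivity
  have hr1 : ∀ n, r n ≤ 1 := fun n => by
    simp only [r]
    rw [div_le_one (by positivity)]
    linarith [Nat.cast_nonneg (α := ℝ) n]
  have hr0 : Tendsto r atTop (𝓝 0) := tendsto_one_div_add_atTop_nhds_zero_nat
  let x : ℕ → X := fun n => x₀ - r n • v
  have hx : Tendsto x atTop (𝓝 x₀) := by
    simpa using tendsto_const_nhds.sub (hr0.smul_const v)
  have hside : ∀ n, f (a (x n)) ≤ f y₀ := fun n => by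
    have h := hA' (x n) x₀ _ (hsub _ (ha (x n))) y₀ hy₀
    have h1 : x n - x₀ = -(r n • v) := by simp [x]
    simp only [h1, map_neg, map_smul, hv, map_sub, smul_eq_mul,
      sub_apply] at h
    nlinarith [hr n]
  have hbound : ∀ n, a (x n) ∈ Metric.closedBall (0 : X) (C * (‖x₀‖ + ‖v‖)) := fun n => by
    rw [mem_closedBall_zero_iff]
    refine (hgrowth _ _ (ha _)).trans (mul_le_mul_of_nonneg_left ?_ hC)
    refine (norm_sub_le _ _).trans ?_
    rw [norm_smul, Real.norm_of_nonneg (hr n).le]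
    gcongr
    exact mul_le_of_le_one_left (norm_nonneg _) (hr1 n)
  obtain ⟨y, -, φ, hφ, hy⟩ := (isCompact_closedBall _ _).tendsto_subseq hbound
  have hmem : (x₀, y) ∈ {p : X × X | p.2 ∈ A p.1} :=
    hclosed.mem_of_tendsto ((hx.comp hφ.tendsto_atTop).prodMk_nhds hy)
      (Eventually.of_forall fun n => ha _)
  have hlim : f y ≤ f y₀ :=
    le_of_tendsto ((f.continuous.tendsto y).comp hy) (Eventually.of_forall fun n => hside _)
  exact absurd (huf y hmem) (by linarith)

/-! ### The explicit Euler scheme -/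

/-- The `k`-th iterate of the explicit Euler scheme with step `h` for `x' = -a x`, started
at `s`. -/
def eulerStep (a : X → X) (h : ℝ) (s : X) (k : ℕ) : X :=
  (fun x => x - h • a x)^[k] s

theorem eulerStep_succ (a : X → X) (h : ℝ) (s : X) (k : ℕ) :
    eulerStep a h s (k + 1) = eulerStep a h s k - h • a (eulerStep a h s k) :=
  Function.iterate_succ_apply' _ _ _

theorem norm_eulerStep_le {a : X → X} {C : ℝ} (ha : ∀ x, ‖a x‖ ≤ C * ‖x‖)
    {h : ℝ} (hh : 0 ≤ h) (s : X) (k : ℕ) :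
    ‖eulerStep a h s k‖ ≤ Real.exp (C * (k * h)) * ‖s‖ := by
  induction k with
  | zero => simp [eulerStep]
  | succ k ih =>
    have h1 : 1 + C * h ≤ Real.exp (C * h) := by linarith [Real.add_one_le_exp (C * h)]
    calc ‖eulerStep a h s (k + 1)‖
        ≤ ‖eulerStep a h s k‖ + h * ‖a (eulerStep a h s k)‖ := by
          rw [eulerStep_succ]
          refine (norm_sub_le _ _).trans ?_
          rw [norm_smul, Real.norm_of_nonneg hh]
      _ ≤ ‖eulerStep a h s k‖ + h * (C * ‖eulerStep a h s k‖) := by gcongr; exact ha _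
      _ = (1 + C * h) * ‖eulerStep a h s k‖ := by ring
      _ ≤ Real.exp (C * h) * (Real.exp (C * (k * h)) * ‖s‖) := by gcongr
      _ = Real.exp (C * ((k + 1 : ℕ) * h)) * ‖s‖ := by
          rw [← mul_assoc, ← Real.exp_add]
          push_cast
          ring_nf

/-- The speed of the Euler scheme is bounded up to any finite time `T`. -/
theorem norm_apply_eulerStep_le {a : X → X} {C : ℝ} (hC : 0 ≤ C) (ha : ∀ x, ‖a x‖ ≤ C * ‖x‖)
    {h : ℝ} (hh : 0 ≤ h) (s : X) {T : ℝ} {k : ℕ} (hk : k * h ≤ T) :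
    ‖a (eulerStep a h s k)‖ ≤ C * (Real.exp (C * T) * ‖s‖) := by
  refine (ha _).trans ?_
  gcongr
  refine (norm_eulerStep_le ha hh s k).trans ?_
  gcongr

theorem norm_eulerStep_add_sub_le {a : X → X} {h K : ℝ} (hh : 0 ≤ h) (s : X) (j n : ℕ)
    (hK : ∀ k < j + n, ‖a (eulerStep a h s k)‖ ≤ K) :
    ‖eulerStep a h s (j + n) - eulerStep a h s j‖ ≤ n * h * K := by
  induction n with
  | zero => simp
  | succ n ih =>
    have e : eulerStep a h s (j + (n + 1)) - eulerStep a h s j =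
        (eulerStep a h s (j + n) - eulerStep a h s j) - h • a (eulerStep a h s (j + n)) := by
      rw [← add_assoc, eulerStep_succ]
      abel
    rw [e]
    refine (norm_sub_le _ _).trans ?_
    rw [norm_smul, Real.norm_of_nonneg hh]
    have h1 := ih fun k hk => hK k (by omega)
    have h2 := mul_le_mul_of_nonneg_left (hK (j + n) (by omega)) hh
    push_cast
    linarith

/-- A discrete energy inequality: against each point `(x, y)` of the graph of a monotone operator,
the Euler scheme satisfies, up to errors of second order in the elapsed time and of first order in
the step, the inequality obtained by integrating `(d/dt) B (ρ - x) (ρ - x) ≤ -2 B y (ρ - x)`. -/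
theorem IsMonotoneOperator.eulerStep_energy_le (hsymm : ∀ x y, B x y = B y x)
    (hA : IsMonotoneOperator (fun x y => B x y) A) {a : X → X} (ha : ∀ x, a x ∈ A x)
    {h K : ℝ} (hh : 0 ≤ h) (s : X) (j n : ℕ)
    (hK : ∀ k < j + n, ‖a (eulerStep a h s k)‖ ≤ K) {x y : X} (hy : y ∈ A x) :
    B (eulerStep a h s (j + n) - x) (eulerStep a h s (j + n) - x) -
        B (eulerStep a h s j - x) (eulerStep a h s j - x) ≤
      2 * (n * h) * -B y (eulerStep a h s (j + n) - x) +
        2 * (n * h) ^ 2 * (‖B‖ * ‖y‖ * K) + n * h * h * (‖B‖ * K ^ 2) := by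
  induction n with
  | zero => simp
  | succ n ih =>
    have hprev := ih fun k hk => hK k (by omega)
    have hKn := hK (j + n) (by omega)
    have hK0 : 0 ≤ K := (norm_nonneg _).trans hKn
    rw [← add_assoc, eulerStep_succ]
    set u := eulerStep a h s (j + n)
    have hmono : 0 ≤ B (a u - y) (u - x) := hA u x _ (ha u) y hy
    have hquad : B (a u) (a u) ≤ ‖B‖ * K ^ 2 := by
      refine (le_abs_self _).trans ((B.le_opNorm₂ _ _).trans ?_)
      rw [pow_two, ← mul_assoc]
      gcongr
    have hlin : -B y (a u) ≤ ‖B‖ * ‖y‖ * K := by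
      refine (neg_le_abs _).trans ((B.le_opNorm₂ _ _).trans ?_)
      gcongr
    have e1 : u - h • a u - x = (u - x) - h • a u := by abel
    have e2 : B (u - h • a u - x) (u - h • a u - x) =
        B (u - x) (u - x) - 2 * h * B (a u) (u - x) + h ^ 2 * B (a u) (a u) := by
      rw [e1]
      generalize u - x = v
      simp only [map_sub, map_smul, sub_apply, smul_apply,
        smul_eq_mul]
      rw [hsymm v (a u)]
      ring
    have e3 : B y (u - h • a u - x) = B y (u - x) - h * B y (a u) := by
      rw [e1, map_sub, map_smul, smul_eq_mul]
    rw [e2, e3]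
    rw [map_sub B, sub_apply] at hmono
    have hn : (0 : ℝ) ≤ n := n.cast_nonneg
    have f1 := mul_le_mul_of_nonneg_left hmono (by positivity : 0 ≤ 2 * h)
    have f2 := mul_le_mul_of_nonneg_left hquad (by positivity : 0 ≤ h ^ 2)
    have f3 := mul_le_mul_of_nonneg_left hlin (by positivity : 0 ≤ 2 * (n + 1) * h ^ 2)
    -- The quadratic error closes up because `n ^ 2 + (n + 1) ≤ (n + 1) ^ 2`.
    have f4 : 0 ≤ 2 * n * h ^ 2 * (‖B‖ * ‖y‖ * K) := by positivity
    push_cast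
    nlinarith

/-! ### Existence of solutions -/

/-- If `B (ρ - x) (ρ - x)` satisfies the integrated energy inequality against `(x, y)` on short
intervals ending at `t`, then a derivative of `ρ` at `t` satisfies the differential one. -/
theorem apply_deriv_add_le_zero_of_energy_le (hsymm : ∀ x y, B x y = B y x) {ρ : ℝ → X} {t c : ℝ}
    {v x y : X} (ht : 0 < t) (hv : HasDerivAt ρ v t)
    (h : ∀ r, 0 ≤ r → r ≤ t → B (ρ t - x) (ρ t - x) - B (ρ r - x) (ρ r - x) ≤
      2 * (t - r) * -B y (ρ t - x) + 2 * (t - r) ^ 2 * c) :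
    B (v + y) (ρ t - x) ≤ 0 := by
  let g : ℝ → ℝ := fun r =>
    B (ρ r - x) (ρ r - x) + 2 * (t - r) * -B y (ρ t - x) + 2 * (t - r) ^ 2 * c
  have hw : HasDerivAt (fun r => ρ r - x) v t := hv.sub_const x
  have hq : HasDerivAt (fun r => B (ρ r - x) (ρ r - x))
      (B v (ρ t - x) + B (ρ t - x) v) t :=
    (B.hasFDerivAt.comp_hasDerivAt t hw).clm_apply hw
  have hl : HasDerivAt (fun r => t - r) (-1) t := by
    simpa using (hasDerivAt_id t).const_sub t
  have hg : HasDerivAt g (2 * B (v + y) (ρ t - x)) t := by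
    refine ((hq.add ((hl.const_mul 2).mul_const _)).add
      (((hl.pow 2).const_mul 2).mul_const c)).congr_deriv ?_
    rw [hsymm (ρ t - x) v, map_add, add_apply]
    simp
    ring
  -- `g` attains its minimum over `[0, t]` at `t`, so all its left slopes at `t` are non-positive.
  have hslope := (hasDerivWithinAt_iff_tendsto_slope' (by simp)).1
    (hg.hasDerivWithinAt (s := Set.Iio t))
  have hle : 2 * B (v + y) (ρ t - x) ≤ 0 := by
    refine le_of_tendsto hslope ?_
    filter_upwards [Ico_mem_nhdsLT ht] with r hr
    have := h r hr.1 hr.2.le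
    rw [slope_def_field]
    refine div_nonpos_of_nonneg_of_nonpos ?_ (by linarith [hr.2])
    simp only [g, sub_self]
    linarith
  linarith

theorem tendsto_floor_mul_step {t : ℝ} (ht : 0 ≤ t) :
    Tendsto (fun n : ℕ => (⌊t * ((n : ℝ) + 1)⌋₊ : ℝ) * ((n : ℝ) + 1)⁻¹) atTop (𝓝 t) :=
  (tendsto_nat_floor_mul_div_atTop ht).comp
    (tendsto_atTop_add_const_right _ _ tendsto_natCast_atTop_atTop)

/-- Existence for `x' ∈ -A x`. The Euler step functions with step `1 / (n + 1)` are bounded on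
bounded intervals, so they converge pointwise along an ultrafilter. The limit `ρ` is locally
Lipschitz, and it inherits the energy inequality against every point of the graph of `A`. Where `ρ`
is differentiable this says that `-ρ'` is monotonically related to the graph, so that it lies in
`A (ρ t)` by maximality. -/
theorem IsMaximalMonotoneOperator.exists_solution [FiniteDimensional ℝ X]
    (hsymm : ∀ x y, B x y = B y x)
    (hA : IsMaximalMonotoneOperator (fun x y => B x y) A) (hne : ∀ x, (A x).Nonempty)
    {C : ℝ} (hC : 0 ≤ C) (hgrowth : ∀ x, ∀ y ∈ A x, ‖y‖ ≤ C * ‖x‖) (s : X) :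
    ∃ ρ : ℝ → X, ρ 0 = s ∧ (∀ T, 0 ≤ T → ∃ K, LipschitzOnWith K ρ (Set.Icc 0 T)) ∧
      ∀ᵐ t, 0 < t → ∃ y ∈ A (ρ t), HasDerivAt ρ (-y) t := by
  have : ProperSpace X := FiniteDimensional.proper_real X
  choose a ha using hne
  have hag : ∀ x, ‖a x‖ ≤ C * ‖x‖ := fun x => hgrowth x _ (ha x)
  let h : ℕ → ℝ := fun n => ((n : ℝ) + 1)⁻¹
  have hh : ∀ n, 0 < h n := fun n => by positivity
  let N : ℕ → ℝ → ℕ := fun n t => ⌊t * ((n : ℝ) + 1)⌋₊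
  have hN : ∀ n t, 0 ≤ t → N n t * h n ≤ t := fun n t ht => by
    simp only [h, N]
    rw [← div_eq_mul_inv, div_le_iff₀ (by positivity)]
    exact Nat.floor_le (by positivity)
  let u : ℕ → ℝ → X := fun n t => eulerStep a (h n) s (N n t)
  have hbound : ∀ t, 0 ≤ t → ∀ n, u n t ∈ Metric.closedBall (0 : X) (Real.exp (C * t) * ‖s‖) :=
    fun t ht n => by
      rw [mem_closedBall_zero_iff]
      refine (norm_eulerStep_le hag (hh n).le s _).trans ?_
      gcongr
      exact hN n t ht
  let U : Ultrafilter ℕ := hyperfilter ℕ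
  have hU : (U : Filter ℕ) ≤ atTop := Nat.hyperfilter_le_atTop
  have hlim : ∀ t, ∃ z, 0 ≤ t → Tendsto (fun n => u n t) U (𝓝 z) := fun t => by
    by_cases ht : 0 ≤ t
    · obtain ⟨z, -, hz⟩ := (isCompact_closedBall (0 : X) _).ultrafilter_le_nhds
        (U.map fun n => u n t)
        (tendsto_principal.2 (Eventually.of_forall (hbound t ht)))
      exact ⟨z, fun _ => hz⟩
    · exact ⟨0, fun h => absurd h ht⟩
  choose ρ hρ using hlim
  have hh0 : Tendsto h U (𝓝 0) := by
    have := (tendsto_one_div_add_atTop_nhds_zero_nat (𝕜 := ℝ)).mono_left hU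
    simpa [h] using this
  let K : ℝ → ℝ := fun T => C * (Real.exp (C * T) * ‖s‖)
  have hK0 : ∀ T, 0 ≤ K T := fun T => by positivity
  -- For `r ≤ t` the discrete estimates apply with `j = N n r` and `N n t = j + k`.
  have hsplit : ∀ n r t, r ≤ t → ∃ k : ℕ, N n t = N n r + k := fun n r t hrt =>
    Nat.exists_eq_add_of_le (Nat.floor_mono (by gcongr))
  have hspeed : ∀ n r t k, 0 ≤ t → N n t = N n r + k →
      ∀ i < N n r + k, ‖a (eulerStep a (h n) s i)‖ ≤ K t := fun n r t k ht hk i hi => by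
    refine norm_apply_eulerStep_le hC hag (hh n).le s ((hN n t ht).trans' ?_)
    have : i ≤ N n t := by omega
    have := (hh n).le
    gcongr
  have htime : ∀ r t, 0 ≤ r → 0 ≤ t →
      Tendsto (fun n => (N n t : ℝ) * h n - N n r * h n) U (𝓝 (t - r)) := fun r t hr ht =>
    ((tendsto_floor_mul_step ht).mono_left hU).sub ((tendsto_floor_mul_step hr).mono_left hU)
  have hdist : ∀ r t, 0 ≤ r → r ≤ t → ‖ρ t - ρ r‖ ≤ (t - r) * K t := fun r t hr hrt => by
    have ht := hr.trans hrt
    refine le_of_tendsto_of_tendsto' ((hρ t ht).sub (hρ r hr)).norm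
      ((htime r t hr ht).mul_const (K t)) fun n => ?_
    obtain ⟨k, hk⟩ := hsplit n r t hrt
    have := norm_eulerStep_add_sub_le (hh n).le s (N n r) k (hspeed n r t k ht hk)
    simp only [u]
    rw [hk]
    refine this.trans (le_of_eq ?_)
    push_cast
    ring
  have henergy : ∀ r t, 0 ≤ r → r ≤ t → ∀ x, ∀ y ∈ A x,
      B (ρ t - x) (ρ t - x) - B (ρ r - x) (ρ r - x) ≤
        2 * (t - r) * -B y (ρ t - x) + 2 * (t - r) ^ 2 * (‖B‖ * ‖y‖ * K t) := by
    intro r t hr hrt x y hy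
    have ht := hr.trans hrt
    have hq : ∀ τ, 0 ≤ τ → Tendsto (fun n => B (u n τ - x) (u n τ - x)) U
        (𝓝 (B (ρ τ - x) (ρ τ - x))) := fun τ hτ =>
      ((by fun_prop : Continuous fun z => B (z - x) (z - x)).tendsto _).comp (hρ τ hτ)
    have hl : Tendsto (fun n => -B y (u n t - x)) U (𝓝 (-B y (ρ t - x))) :=
      ((by fun_prop : Continuous fun z => -B y (z - x)).tendsto _).comp (hρ t ht)
    have hτ := htime r t hr ht
    have hright := (((hτ.const_mul 2).mul hl).add
      (((hτ.pow 2).const_mul 2).mul_const (‖B‖ * ‖y‖ * K t))).add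
        ((hτ.mul hh0).mul_const (‖B‖ * K t ^ 2))
    rw [mul_zero, zero_mul, add_zero] at hright
    refine le_of_tendsto_of_tendsto' ((hq t ht).sub (hq r hr)) hright fun n => ?_
    obtain ⟨k, hk⟩ := hsplit n r t hrt
    have := hA.1.eulerStep_energy_le hsymm ha (hh n).le s (N n r) k (hspeed n r t k ht hk) hy
    have e : (N n t : ℝ) * h n - N n r * h n = k * h n := by
      rw [hk]
      push_cast
      ring
    rw [e]
    simp only [u]
    rw [hk]
    exact this
  have hlip : ∀ T, 0 ≤ T → LipschitzOnWith (K T).toNNReal ρ (Set.Icc 0 T) := fun T hT => by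
    refine LipschitzOnWith.of_dist_le_mul fun t ht r hr => ?_
    rw [Real.coe_toNNReal _ (hK0 T)]
    wlog hrt : r ≤ t generalizing r t
    · rw [dist_comm, dist_comm t]
      exact this r hr t ht (le_of_not_ge hrt)
    rw [dist_eq_norm, Real.dist_eq, abs_of_nonneg (sub_nonneg.2 hrt), mul_comm]
    refine (hdist r t hr.1 hrt).trans (mul_le_mul_of_nonneg_left ?_ (sub_nonneg.2 hrt))
    have := ht.2
    simp only [K]
    gcongr
  refine ⟨ρ, ?_, fun T hT => ⟨_, hlip T hT⟩, ?_⟩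
  · refine tendsto_nhds_unique (hρ 0 le_rfl) ?_
    simp [u, N, eulerStep]
  · have hdiff : ∀ᵐ t, ∀ n : ℕ, t ∈ Set.Icc (0 : ℝ) n →
        DifferentiableWithinAt ℝ ρ (Set.Icc 0 n) t :=
      ae_all_iff.2 fun n => (hlip n n.cast_nonneg).ae_differentiableWithinAt_of_mem_real
    filter_upwards [hdiff] with t htd ht
    obtain ⟨n, hn⟩ := exists_nat_gt t
    have hd := ((htd n ⟨ht.le, hn.le⟩).differentiableAt (Icc_mem_nhds ht hn)).hasDerivAt
    refine ⟨-deriv ρ t, hA.mem_of_forall fun x y hy => ?_, by rwa [neg_neg]⟩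
    have := apply_deriv_add_le_zero_of_energy_le hsymm ht hd
      fun r hr hrt => henergy r t hr hrt x y hy
    rw [← neg_add', map_neg, neg_apply]
    linarith

/-! ### Uniqueness of absolutely continuous solutions -/

theorem LipschitzOnWith.comp_absolutelyContinuousOnInterval {Y Z : Type*}
    [PseudoMetricSpace Y] [PseudoMetricSpace Z] {g : Y → Z} {f : ℝ → Y} {K : NNReal} {S : Set Y}
    {a b : ℝ} (hg : LipschitzOnWith K g S)
    (hf : AbsolutelyContinuousOnInterval f a b) (hS : ∀ t ∈ Set.uIcc a b, f t ∈ S) :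
    AbsolutelyContinuousOnInterval (fun t => g (f t)) a b := by
  rw [absolutelyContinuousOnInterval_iff] at hf ⊢
  intro ε hε
  obtain ⟨δ, hδ, h⟩ := hf (ε / (K + 1)) (by positivity)
  refine ⟨δ, hδ, fun I hI hlt => ?_⟩
  calc ∑ i ∈ Finset.range I.1, dist (g (f (I.2 i).1)) (g (f (I.2 i).2))
      ≤ ∑ i ∈ Finset.range I.1, K * dist (f (I.2 i).1) (f (I.2 i).2) :=
        Finset.sum_le_sum fun i hi =>
          hg.dist_le_mul _ (hS _ (hI.1 i hi).1) _ (hS _ (hI.1 i hi).2)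
    _ = K * ∑ i ∈ Finset.range I.1, dist (f (I.2 i).1) (f (I.2 i).2) := by rw [Finset.mul_sum]
    _ ≤ K * (ε / (K + 1)) := by gcongr; exact (h I hI hlt).le
    _ < (K + 1) * (ε / (K + 1)) := by gcongr; linarith
    _ = ε := by field

theorem AbsolutelyContinuousOnInterval.bilinear_self (hsymm : ∀ x y, B x y = B y x)
    {f : ℝ → X} {a b : ℝ} (hf : AbsolutelyContinuousOnInterval f a b) :
    AbsolutelyContinuousOnInterval (fun t => B (f t) (f t)) a b := by
  obtain ⟨R, hR⟩ := hf.exists_bound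
  have hR0 : 0 ≤ R := (norm_nonneg _).trans (hR a Set.left_mem_uIcc)
  have hlip : LipschitzOnWith (Real.toNNReal (‖B‖ * (2 * R))) (fun x => B x x)
      {x | ‖x‖ ≤ R} := by
    refine LipschitzOnWith.of_dist_le_mul fun x hx y hy => ?_
    rw [Real.coe_toNNReal _ (by positivity), Real.dist_eq, dist_eq_norm]
    have h1 : B x x - B y y = B (x + y) (x - y) := by
      simp only [map_add, map_sub, add_apply]
      rw [hsymm x y]
      ring
    rw [h1, ← Real.norm_eq_abs]
    refine (B.le_opNorm₂ _ _).trans ?_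
    gcongr
    rw [Set.mem_ofPred_eq] at hx hy
    exact (norm_add_le _ _).trans (by linarith)
  exact hlip.comp_absolutelyContinuousOnInterval hf hR

/-- Two absolutely continuous solutions of `x' ∈ -A x` with the same initial value agree: by
monotonicity `B w w`, where `w` is their difference, is non-increasing. -/
theorem IsMonotoneOperator.eq_of_absolutelyContinuous (hsymm : ∀ x y, B x y = B y x)
    (hpos : ∀ x, x ≠ 0 → 0 < B x x) (hA : IsMonotoneOperator (fun x y => B x y) A)
    {ρ ρ' : ℝ → X} {T : ℝ} (hT : 0 ≤ T)
    (hρ : AbsolutelyContinuousOnInterval ρ 0 T) (hρ' : AbsolutelyContinuousOnInterval ρ' 0 T)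
    (h0 : ρ 0 = ρ' 0)
    (hd : ∀ᵐ t ∂volume.restrict (Set.Ici (0 : ℝ)), ∃ y ∈ A (ρ t), HasDerivAt ρ (-y) t)
    (hd' : ∀ᵐ t ∂volume.restrict (Set.Ici (0 : ℝ)), ∃ y ∈ A (ρ' t), HasDerivAt ρ' (-y) t) :
    ρ T = ρ' T := by
  have hint := ((hρ.fun_sub hρ').bilinear_self hsymm).integral_deriv_eq_sub
  have hle : 0 ≤ ∫ t in 0..T, -deriv (fun t => B (ρ t - ρ' t) (ρ t - ρ' t)) t := by
    refine intervalIntegral.integral_nonneg_of_ae_restrict hT ?_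
    refine ae_restrict_of_ae_restrict_of_subset Set.Icc_subset_Ici_self ?_
    filter_upwards [hd, hd'] with t ⟨y, hy, h⟩ ⟨y', hy', h'⟩
    have hw := h.sub h'
    have hq := (B.hasFDerivAt.comp_hasDerivAt t hw).clm_apply hw
    have hmono := hA _ _ y hy y' hy'
    have heq : (fun t => B (ρ t - ρ' t) (ρ t - ρ' t)) =
        fun t => (B ∘ (ρ - ρ')) t ((ρ - ρ') t) := rfl
    rw [heq, hq.deriv]
    have e : -y - -y' = -(y - y') := by abel
    simp only [e, Function.comp, Pi.sub_apply, map_neg, neg_apply,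
      Pi.zero_apply] at hmono ⊢
    rw [hsymm (ρ t - ρ' t)]
    linarith
  rw [intervalIntegral.integral_neg, hint] at hle
  by_contra hne
  have := hpos _ (sub_ne_zero.2 hne)
  simp only [h0, sub_self, map_zero] at hle
  linarith

end Abstract

/-! ### Dot products -/

theorem Matrix.vecMulVec_self_mulVec {V : Type*} [Fintype V] (b x : V → ℝ) :
    Matrix.vecMulVec b b *ᵥ x = (b ⬝ᵥ x) • b := by
  rw [Matrix.vecMulVec_mulVec]
  simp

theorem abs_dotProduct_le_card_mul_norm {V : Type*} [Fintype V] (b x : V → ℝ) :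
    |b ⬝ᵥ x| ≤ Fintype.card V * (‖b‖ * ‖x‖) := by
  calc |b ⬝ᵥ x| ≤ ∑ v, |b v * x v| := Finset.abs_sum_le_sum_abs _ _
    _ ≤ ∑ _v : V, ‖b‖ * ‖x‖ := by
        refine Finset.sum_le_sum fun v _ => ?_
        rw [abs_mul]
        gcongr
        exacts [norm_le_pi_norm b v, norm_le_pi_norm x v]
    _ = _ := by simp

namespace WeightedHypergraph

variable {V E : Type*} [DecidableEq V] (G : WeightedHypergraph V E)

/-! ### The polytopes `B_e` and their faces -/

theorem isCompact_polytope (e : E) : IsCompact (G.polytope e) := by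
  refine Set.Finite.isCompact_convexHull ℝ ?_
  refine (((G.verts e) ×ˢ (G.verts e)).finite_toSet.image
    fun p : V × V => (Pi.single p.1 1 - Pi.single p.2 1 : V → ℝ)).subset ?_
  rintro b ⟨u, hu, v, hv, rfl⟩
  exact ⟨(u, v), by simp [hu, hv], rfl⟩

theorem zero_mem_polytope (e : E) : (0 : V → ℝ) ∈ G.polytope e := by
  obtain ⟨u, hu⟩ := G.verts_nonempty e
  exact subset_convexHull ℝ _ ⟨u, hu, u, hu, by simp⟩

variable [Fintype V]

theorem norm_le_of_mem_polytope {e : E} {b : V → ℝ} (hb : b ∈ G.polytope e) : ‖b‖ ≤ 2 := by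
  have hsub : G.polytope e ⊆ Metric.closedBall 0 2 := by
    refine convexHull_min ?_ (convex_closedBall _ _)
    rintro b ⟨u, -, v, -, rfl⟩
    rw [mem_closedBall_zero_iff]
    refine (norm_sub_le _ _).trans ?_
    rw [Pi.norm_single, Pi.norm_single]
    norm_num
  simpa using hsub hb

theorem argmaxPolytope_nonempty (e : E) (x : V → ℝ) : (G.argmaxPolytope e x).Nonempty := by
  obtain ⟨b, hb, hmax⟩ := (G.isCompact_polytope e).exists_isMaxOn ⟨0, G.zero_mem_polytope e⟩
    (f := fun b : V → ℝ => b ⬝ᵥ x) (by fun_prop)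
  exact ⟨b, hb, hmax⟩

theorem convex_argmaxPolytope (e : E) (x : V → ℝ) : Convex ℝ (G.argmaxPolytope e x) := by
  rintro b ⟨hb, hb'⟩ c ⟨hc, hc'⟩ p q hp hq hpq
  refine ⟨convex_convexHull ℝ _ hb hc hp hq hpq, fun d hd => ?_⟩
  rw [add_dotProduct, smul_dotProduct, smul_dotProduct, smul_eq_mul, smul_eq_mul]
  calc d ⬝ᵥ x = p * (d ⬝ᵥ x) + q * (d ⬝ᵥ x) := by rw [← add_mul, hpq, one_mul]
    _ ≤ _ := by gcongr; exacts [hb' d hd, hc' d hd]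

theorem argmaxPolytope_dotProduct_eq {e : E} {x b c : V → ℝ} (hb : b ∈ G.argmaxPolytope e x)
    (hc : c ∈ G.argmaxPolytope e x) : b ⬝ᵥ x = c ⬝ᵥ x :=
  (hc.2 b hb.1).antisymm (hb.2 c hc.1)

theorem argmaxPolytope_dotProduct_nonneg {e : E} {x b : V → ℝ} (hb : b ∈ G.argmaxPolytope e x) :
    0 ≤ b ⬝ᵥ x := by
  simpa using hb.2 0 (G.zero_mem_polytope e)

/-! ### The multivalued Laplacian -/

variable [Fintype E]

theorem laplacian_nonempty (x : V → ℝ) : (G.laplacian x).Nonempty := by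
  choose b hb using fun e => G.argmaxPolytope_nonempty e x
  exact ⟨_, b, hb, rfl⟩

/-- On a face `argmax_{b ∈ B_e} bᵀ x` the factor `bᵀ x` is constant, so `b bᵀ x` is affine in `b`
there and `L_G(x)` is convex. -/
theorem convex_laplacian (x : V → ℝ) : Convex ℝ (G.laplacian x) := by
  rintro _ ⟨b, hb, rfl⟩ _ ⟨c, hc, rfl⟩ p q hp hq hpq
  have hd : ∀ e, p • b e + q • c e ∈ G.argmaxPolytope e x := fun e =>
    G.convex_argmaxPolytope e x (hb e) (hc e) hp hq hpq
  refine ⟨fun e => p • b e + q • c e, hd, ?_⟩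
  rw [Finset.smul_sum, Finset.smul_sum, ← Finset.sum_add_distrib]
  refine Finset.sum_congr rfl fun e _ => ?_
  simp only [Matrix.vecMulVec_self_mulVec]
  rw [G.argmaxPolytope_dotProduct_eq (hb e) (hd e), G.argmaxPolytope_dotProduct_eq (hc e) (hd e)]
  module

/-- Monotonicity of `L_G` for the standard inner product. For each hyperedge, with maximal values
`p` at `x` and `q` at `x'`, the contribution is at least `p² - 2 p q + q²`. -/
theorem laplacian_monotone {x x' y y' : V → ℝ} (hy : y ∈ G.laplacian x)
    (hy' : y' ∈ G.laplacian x') : 0 ≤ (y - y') ⬝ᵥ (x - x') := by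
  obtain ⟨b, hb, rfl⟩ := hy
  obtain ⟨c, hc, rfl⟩ := hy'
  rw [← Finset.sum_sub_distrib, sum_dotProduct]
  refine Finset.sum_nonneg fun e _ => ?_
  rw [← smul_sub, smul_dotProduct, smul_eq_mul]
  refine mul_nonneg (G.weight_nonneg e) ?_
  simp only [Matrix.vecMulVec_self_mulVec, sub_dotProduct, dotProduct_sub, smul_dotProduct, smul_eq_mul]
  have h1 := mul_le_mul_of_nonneg_left ((hc e).2 (b e) (hb e).1)
    (G.argmaxPolytope_dotProduct_nonneg (hb e))
  have h2 := mul_le_mul_of_nonneg_left ((hb e).2 (c e) (hc e).1)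
    (G.argmaxPolytope_dotProduct_nonneg (hc e))
  nlinarith [sq_nonneg (b e ⬝ᵥ x - c e ⬝ᵥ x')]

theorem norm_le_of_mem_laplacian {x y : V → ℝ} (hy : y ∈ G.laplacian x) :
    ‖y‖ ≤ (∑ e, G.weight e * (4 * Fintype.card V)) * ‖x‖ := by
  obtain ⟨b, hb, rfl⟩ := hy
  rw [Finset.sum_mul]
  refine (norm_sum_le _ _).trans (Finset.sum_le_sum fun e _ => ?_)
  have h2 := G.norm_le_of_mem_polytope (hb e).1
  rw [Matrix.vecMulVec_self_mulVec, norm_smul, norm_smul, Real.norm_of_nonneg (G.weight_nonneg e),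
    Real.norm_eq_abs, mul_assoc]
  refine mul_le_mul_of_nonneg_left ?_ (G.weight_nonneg e)
  calc |b e ⬝ᵥ x| * ‖b e‖ ≤ (Fintype.card V * (2 * ‖x‖)) * 2 := by
        gcongr
        refine (abs_dotProduct_le_card_mul_norm _ _).trans ?_
        gcongr
    _ = _ := by ring

/-- The graph of `L_G` is closed: the maximizers `b_e` range over compact polytopes, and a limit of
maximizers is a maximizer. -/
theorem isClosed_graph_laplacian :
    IsClosed {p : (V → ℝ) × (V → ℝ) | p.2 ∈ G.laplacian p.1} := by
  refine isClosed_of_closure_subset fun p hp => ?_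
  obtain ⟨q, hq, hlim⟩ := mem_closure_iff_seq_limit.1 hp
  choose b hb hqb using hq
  have hK : IsCompact (Set.univ.pi fun e => G.polytope e) :=
    isCompact_univ_pi fun e => G.isCompact_polytope e
  obtain ⟨c, hc, φ, hφ, hbc⟩ := hK.tendsto_subseq (x := b) fun n e _ => (hb n e).1
  have hq1 : Tendsto (fun n => (q (φ n)).1) atTop (𝓝 p.1) :=
    ((continuous_fst.tendsto p).comp hlim).comp hφ.tendsto_atTop
  have hq2 : Tendsto (fun n => (q (φ n)).2) atTop (𝓝 p.2) :=
    ((continuous_snd.tendsto p).comp hlim).comp hφ.tendsto_atTop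
  have hdot : Continuous fun r : (V → ℝ) × (V → ℝ) => r.1 ⬝ᵥ r.2 := by fun_prop
  have hbe : ∀ e, Tendsto (fun n => b (φ n) e) atTop (𝓝 (c e)) := fun e =>
    ((continuous_apply e).tendsto c).comp hbc
  have hbx : ∀ e, Tendsto (fun n => b (φ n) e ⬝ᵥ (q (φ n)).1) atTop (𝓝 (c e ⬝ᵥ p.1)) :=
    fun e => (hdot.tendsto _).comp ((hbe e).prodMk_nhds hq1)
  refine ⟨c, fun e => ⟨hc e trivial, fun d hd => ?_⟩, ?_⟩
  · exact le_of_tendsto_of_tendsto'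
      ((hdot.tendsto (d, p.1)).comp (tendsto_const_nhds.prodMk_nhds hq1)) (hbx e)
      fun n => (hb (φ n) e).2 d hd
  · refine tendsto_nhds_unique hq2 ?_
    simp only [hqb, Matrix.vecMulVec_self_mulVec]
    exact tendsto_finsetSum _ fun e _ => ((hbx e).smul (hbe e)).const_smul _

/-! ### The normalized Laplacian -/

theorem inv_degreeMatrix_mulVec (hdeg : ∀ v, 0 < G.degree v) (x : V → ℝ) :
    G.degreeMatrix⁻¹ *ᵥ x = fun v => x v / G.degree v := by
  have hinv : G.degreeMatrix⁻¹ = Matrix.diagonal fun v => (G.degree v)⁻¹ := by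
    refine Matrix.inv_eq_right_inv ?_
    rw [degreeMatrix, Matrix.diagonal_mul_diagonal, ← Matrix.diagonal_one]
    congr 1
    ext v
    exact mul_inv_cancel₀ (hdeg v).ne'
  ext v
  rw [hinv, Matrix.mulVec_diagonal, div_eq_inv_mul]

/-- The inner product `⟨x, y⟩_{D⁻¹}` as a continuous bilinear form. -/
noncomputable def innerDInvForm : (V → ℝ) →L[ℝ] (V → ℝ) →L[ℝ] ℝ :=
  LinearMap.toContinuousLinearMap
    ((LinearMap.toContinuousLinearMap : ((V → ℝ) →ₗ[ℝ] ℝ) ≃ₗ[ℝ] ((V → ℝ) →L[ℝ] ℝ)).toLinearMap ∘ₗ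
      Matrix.toLinearMap₂' ℝ G.degreeMatrix⁻¹)

theorem innerDInvForm_apply (x y : V → ℝ) : G.innerDInvForm x y = G.innerDInv x y := by
  simp [innerDInvForm, innerDInv, Matrix.toLinearMap₂'_apply']

theorem innerDInvForm_eq_sum (hdeg : ∀ v, 0 < G.degree v) (x y : V → ℝ) :
    G.innerDInvForm x y = ∑ v, x v * (y v / G.degree v) := by
  rw [innerDInvForm_apply, innerDInv, G.inv_degreeMatrix_mulVec hdeg]
  rfl

theorem innerDInvForm_comm (hdeg : ∀ v, 0 < G.degree v) (x y : V → ℝ) :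
    G.innerDInvForm x y = G.innerDInvForm y x := by
  simp only [G.innerDInvForm_eq_sum hdeg]
  exact Finset.sum_congr rfl fun v _ => by ring

theorem innerDInvForm_self_pos (hdeg : ∀ v, 0 < G.degree v) {x : V → ℝ} (hx : x ≠ 0) :
    0 < G.innerDInvForm x x := by
  obtain ⟨v, hv⟩ := Function.ne_iff.1 hx
  have hterm : ∀ v, x v * (x v / G.degree v) = x v ^ 2 / G.degree v := fun v => by ring
  simp only [G.innerDInvForm_eq_sum hdeg, hterm]
  refine Finset.sum_pos' (fun w _ => div_nonneg (sq_nonneg _) (hdeg w).le)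
    ⟨v, Finset.mem_univ v, ?_⟩
  exact div_pos (sq_pos_of_ne_zero hv) (hdeg v)

theorem isMonotoneOperator_normalizedLaplacian :
    IsMonotoneOperator (fun x y => G.innerDInvForm x y) G.normalizedLaplacian := by
  intro x x' y hy y' hy'
  simp only [innerDInvForm_apply, innerDInv, Matrix.mulVec_sub]
  exact G.laplacian_monotone hy hy'

theorem exists_norm_le_of_mem_normalizedLaplacian :
    ∃ C, 0 ≤ C ∧ ∀ x, ∀ y ∈ G.normalizedLaplacian x, ‖y‖ ≤ C * ‖x‖ := by
  let L : (V → ℝ) →L[ℝ] (V → ℝ) := LinearMap.toContinuousLinearMap G.degreeMatrix⁻¹.mulVecLin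
  have hw : 0 ≤ ∑ e, G.weight e * (4 * Fintype.card V) :=
    Finset.sum_nonneg fun e _ => mul_nonneg (G.weight_nonneg e) (by positivity)
  refine ⟨(∑ e, G.weight e * (4 * Fintype.card V)) * ‖L‖, by positivity, fun x y hy => ?_⟩
  refine (G.norm_le_of_mem_laplacian hy).trans ?_
  rw [mul_assoc]
  exact mul_le_mul_of_nonneg_left (L.le_opNorm x) hw

theorem isMaximalMonotoneOperator_normalizedLaplacian (hdeg : ∀ v, 0 < G.degree v) :
    IsMaximalMonotoneOperator (fun x y => G.innerDInvForm x y) G.normalizedLaplacian := by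
  obtain ⟨C, hC, hgrowth⟩ := G.exists_norm_le_of_mem_normalizedLaplacian
  refine G.isMonotoneOperator_normalizedLaplacian.isMaximalMonotoneOperator
    (fun x hx => G.innerDInvForm_self_pos hdeg hx) (fun x => G.laplacian_nonempty _)
    (fun x => G.convex_laplacian _) ?_ hC hgrowth
  exact G.isClosed_graph_laplacian.preimage
    (f := fun p : (V → ℝ) × (V → ℝ) => (G.degreeMatrix⁻¹ *ᵥ p.1, p.2)) (by fun_prop)

end WeightedHypergraph

theorem mainTheorem3 {V E : Type*} [Fintype V] [DecidableEq V] [Fintype E]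
    (G : WeightedHypergraph V E) (hdeg : ∀ v, 0 < G.degree v) :
    IsMaximalMonotoneOperator G.innerDInv G.normalizedLaplacian ∧
    ∀ s : V → ℝ, ∃ ρ : ℝ → V → ℝ, G.IsHeatSolution s ρ ∧
      ∀ ρ' : ℝ → V → ℝ, G.IsHeatSolution s ρ' → ∀ t : ℝ, 0 ≤ t → ρ' t = ρ t := by
  have hsymm := G.innerDInvForm_comm hdeg
  have hmax := G.isMaximalMonotoneOperator_normalizedLaplacian hdeg
  obtain ⟨C, hC, hgrowth⟩ := G.exists_norm_le_of_mem_normalizedLaplacian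
  refine ⟨by simpa only [G.innerDInvForm_apply] using hmax, fun s => ?_⟩
  obtain ⟨ρ, h0, hlip, hderiv⟩ :=
    hmax.exists_solution hsymm (fun x => G.laplacian_nonempty _) hC hgrowth s
  have hsol : G.IsHeatSolution s ρ := by
    refine ⟨fun T hT => ?_, h0, ?_⟩
    · obtain ⟨K, hK⟩ := hlip T hT
      exact LipschitzOnWith.absolutelyContinuousOnInterval (by rwa [Set.uIcc_of_le hT])
    · rw [← restrict_Ioi_eq_restrict_Ici, ae_restrict_iff' measurableSet_Ioi]
      exact hderiv
  exact ⟨ρ, hsol, fun ρ' hρ' t ht => hmax.1.eq_of_absolutelyContinuous hsymm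
    (fun x hx => G.innerDInvForm_self_pos hdeg hx) ht (hρ'.1 t ht) (hsol.1 t ht)
    (hρ'.2.1.trans h0.symm) hρ'.2.2 hsol.2.2⟩
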